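/- Let $m\ge 1$ be a fixed integer. Define random directed multigraphs $G_1^{(n)}$ on $v_1,\dots,v_n$ inductively: $G_1^{(1)}$ is one vertex with one loop, and $G_1^{(n)}$ is obtained from $G_1^{(n-1)}$ by adding the vertex $v_n$ and a single directed edge from $v_n$ to $v_i$, where, given $G_1^{(n-1)}$, $i=s$ with probability $\deg(v_s)/(2n-1)$ for $1\le s\le n-1$ (total degree in $G_1^{(n-1)}$, a loop counting twice) and $i=n$ with probability $1/(2n-1)$. Let $G_m^{(n)}$ be obtained from $G_1^{(mn)}$ by identifying its vertices number $1,\dots,m$ to form the first vertex, its vertices number $m+1,\dots,2m$ to form the second, and so on, keeping all edges. Let $N(n,m,d)$ be the number of vertices of in-degree $d$ in $G_m^{(n)}$. Then there are constants $0<c,C<\infty$ depending only on $m$ such that, for every $\varepsilon>0$ and every sequence of integers $d=d(n)$ with $1\le d(n)\le n^{1/6-\varepsilon}$ for all large $n$, $$\Pr\left[\frac{c}{d^{3}}\le \frac{N(n,m,d)}{n}\le \frac{C}{d^{3}}\right]\longrightarrow 1\qquad (n\to\infty);$$ more precisely, for every $\eta>0$, $$\Pr\left[\,\left|\frac{N(n,m,d)}{n}\cdot\frac{(d+m)(d+m+1)(d+m+2)}{2m(m+1)}-1\right|\le\eta\right]\longrightarrow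 1\qquad (n\to\infty).$$ -/

import Mathlib

open Filter Topology
open scoped ENNReal

/-- A finite directed multigraph with vertex set `V` and edges labelled by `E`
(loops and parallel edges are allowed). -/
@[ext]
structure DirMultigraph (V E : Type) where
  /-- the tail of an edge -/
  src : E → V
  /-- the head of an edge -/
  tgt : E → V

namespace DirMultigraph

variable {V E : Type} [DecidableEq V] [Fintype E]

/-- The number of edges pointing to `v` (a loop at `v` is one of them). -/
def inDegree (G : DirMultigraph V E) (v : V) : ℕ :=
  (Finset.univ.filter fun e => G.tgt e = v).card

/-- The number of edges leaving `v`. -/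
def outDegree (G : DirMultigraph V E) (v : V) : ℕ :=
  (Finset.univ.filter fun e => G.src e = v).card

/-- The total degree of `v`; a loop contributes two. -/
def degree (G : DirMultigraph V E) (v : V) : ℕ :=
  G.inDegree v + G.outDegree v

theorem sum_degree [Fintype V] (G : DirMultigraph V E) :
    ∑ v, G.degree v = 2 * Fintype.card E := by
  have h1 : ∑ v, G.inDegree v = Fintype.card E :=
    (Finset.card_eq_sum_card_fiberwise (f := G.tgt) (s := Finset.univ) (t := Finset.univ)
      (fun _ _ => Finset.mem_coe.2 (Finset.mem_univ _))).symm
  have h2 : ∑ v, G.outDegree v = Fintype.card E :=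
    (Finset.card_eq_sum_card_fiberwise (f := G.src) (s := Finset.univ) (t := Finset.univ)
      (fun _ _ => Finset.mem_coe.2 (Finset.mem_univ _))).symm
  simp only [degree, Finset.sum_add_distrib, h1, h2]
  ring

/-- The number of vertices of in-degree `d`. -/
def numInDegree [Fintype V] (G : DirMultigraph V E) (d : ℕ) : ℕ :=
  (Finset.univ.filter fun v => G.inDegree v = d).card

/-- The graph obtained by mapping the vertices along `f` (identifying vertices with the same
image) and keeping all the edges. -/
def mapVertices {W : Type} (f : V → W) (G : DirMultigraph V E) : DirMultigraph W E where
  src := fun e => f (G.src e)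
  tgt := fun e => f (G.tgt e)

/-- Add to a graph on `v_0, …, v_{n-1}` a new vertex `v_n` and one edge from `v_n` to `v_i`. -/
def addVertex {n : ℕ} (G : DirMultigraph (Fin n) (Fin n)) (i : Fin (n + 1)) :
    DirMultigraph (Fin (n + 1)) (Fin (n + 1)) where
  src := Fin.snoc (α := fun _ => Fin (n + 1)) (fun e => (G.src e).castSucc) (Fin.last n)
  tgt := Fin.snoc (α := fun _ => Fin (n + 1)) (fun e => (G.tgt e).castSucc) i

/-- The probability that the edge of the new vertex `v_n` goes to `v_i`: it is
`degree(v_i) / (2 n + 1)` for an old vertex, and `1 / (2 n + 1)` for `v_n` itself. -/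
noncomputable def attachProb {n : ℕ} (G : DirMultigraph (Fin n) (Fin n)) (i : Fin (n + 1)) :
    ℝ≥0∞ :=
  Fin.lastCases (motive := fun _ => ℝ≥0∞) (1 / (2 * n + 1))
    (fun s : Fin n => (G.degree s : ℝ≥0∞) / (2 * n + 1)) i

theorem sum_attachProb {n : ℕ} (G : DirMultigraph (Fin n) (Fin n)) :
    ∑ i, G.attachProb i = 1 := by
  have h : (∑ s, (G.degree s : ℝ≥0∞)) = 2 * n := by
    have := G.sum_degree
    rw [Fintype.card_fin] at this
    exact_mod_cast this
  rw [Fin.sum_univ_castSucc]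
  simp only [attachProb, Fin.lastCases_castSucc, Fin.lastCases_last]
  simp only [div_eq_mul_inv]
  rw [← Finset.sum_mul, h, ← add_mul]
  refine ENNReal.mul_inv_cancel (by simp) ?_
  exact_mod_cast ENNReal.natCast_ne_top (2 * n + 1)

/-- The law of the end point of the edge of the new vertex. -/
noncomputable def attach {n : ℕ} (G : DirMultigraph (Fin n) (Fin n)) : PMF (Fin (n + 1)) :=
  PMF.ofFintype G.attachProb G.sum_attachProb

end DirMultigraph

/-- The law of the one-connection preferential attachment graph on `n` vertices.
From the empty graph the first step yields one vertex with a loop, see `prefOne_one`. -/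
noncomputable def prefOne : (n : ℕ) → PMF (DirMultigraph (Fin n) (Fin n))
  | 0 => PMF.pure ⟨id, id⟩
  | n + 1 => (prefOne n).bind fun G => G.attach.map G.addVertex

/-- The graph on one vertex is one vertex with a loop. -/
theorem prefOne_one : prefOne 1 = PMF.pure ⟨fun _ => 0, fun _ => 0⟩ := by
  have hs : Subsingleton (DirMultigraph (Fin 1) (Fin 1)) :=
    ⟨fun G H => by ext <;> simp⟩
  have key : ∀ p q : PMF (DirMultigraph (Fin 1) (Fin 1)), p = q := by
    have h1 : ∀ (p : PMF (DirMultigraph (Fin 1) (Fin 1))) G, p G = 1 := fun p G => by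
      rw [← p.tsum_coe]
      exact (tsum_eq_single G fun H hH => absurd (Subsingleton.elim H G) hH).symm
    exact fun p q => PMF.ext fun G => by rw [h1, h1]
  exact key _ _

/-- The law of the `m`-connections preferential attachment graph on `n` vertices: run the
one-connection process up to `n * m` vertices and identify each block of `m` consecutive
vertices (`Fin.divNat` sends `i` to `i / m`). -/
noncomputable def prefGraph (m n : ℕ) : PMF (DirMultigraph (Fin n) (Fin (n * m))) :=
  (prefOne (n * m)).map (DirMultigraph.mapVertices Fin.divNat)

/-- The probability that the proportion of vertices of in-degree `d` in the `m`-connections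
preferential attachment graph on `n` vertices lies in the set `S`. -/
noncomputable def probProportion (m n d : ℕ) (S : Set ℝ) : ℝ≥0∞ :=
  (prefGraph m n).toOuterMeasure {G | (G.numInDegree d : ℝ) / n ∈ S}

/-!
The proof is a second-moment argument. Counting the blocks of in-degree *at least* `k` instead of
exactly `k` makes the dynamics simple: `tailCount m G k` increases by one exactly when the new edge
hits a block of in-degree `k - 1`, which under preferential attachment happens with probability
`(k - 1 + m) / (2 n + 1)` times the number `tailCount m G (k - 1) - tailCount m G k` of such
blocks, up to an error `O(1 / n)` caused by the one incomplete block (`abs_sum_weight_sub_le`).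
Setting `tailCount m G 0 = n / m` gives the right boundary condition, and the mean-field recursion
then has the exact solution `tailLimit m k * (2 n + 1) / 2`.

In the deviation `tailDev` from this solution the recursion reads
`Y (k) ↦ (1 - q) Y (k) + q Y (k - 1) + noise`, with `q = (k - 1 + m) / (2 n + 1)`. By convexity of
the square, `sup_k E[Y (k) ^ 2]` therefore increases by at most a constant in each step: the noise
has bounded variance, and the drift error `O(1 / n)` multiplies a deviation `O(n)`
(`expect_sq_tailDev_addVertex_le`). Hence `E[Y (k) ^ 2] = O(n + k ^ 2)` (`expect_sq_tailDev_le`).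
This single bound controls both the bias of the expectation and the fluctuations.

The number of vertices of in-degree `d ≥ 1` is a difference of two consecutive tail counts, so for
`d ^ 2 ≤ n` its mean-square distance from `degreeLimit m d * n` is `O(n)`. Since
`degreeLimit m d` is of order `d ^ (-3)`, Chebyshev's inequality bounds the probability of a
relative error above `η` by a constant times `d ^ 6 / (η ^ 2 n) ≤ n ^ (-6 ε) / η ^ 2`.
-/

/-! ### Expectations under a probability mass function -/

namespace PMF

variable {α β : Type}

/-- The expectation of a nonnegative extended-real function. Working in `ℝ≥0∞` avoids all
summability side conditions. -/
noncomputable def expect (p : PMF α) (F : α → ℝ≥0∞) : ℝ≥0∞ :=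
  ∑' a, p a * F a

theorem expect_pure (a : α) (F : α → ℝ≥0∞) : (PMF.pure a).expect F = F a := by
  classical
  unfold expect
  rw [tsum_eq_single a]
  · simp
  · intro b hb
    simp [PMF.pure_apply, hb]

theorem expect_bind (p : PMF α) (f : α → PMF β) (F : β → ℝ≥0∞) :
    (p.bind f).expect F = p.expect fun a => (f a).expect F := by
  simp only [expect, PMF.bind_apply, ← ENNReal.tsum_mul_right, ← ENNReal.tsum_mul_left]
  rw [ENNReal.tsum_comm]
  simp only [mul_assoc]

theorem expect_map (p : PMF α) (g : α → β) (F : β → ℝ≥0∞) :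
    (p.map g).expect F = p.expect (F ∘ g) := by
  rw [PMF.map, expect_bind]
  simp only [Function.comp_apply, expect_pure]
  rfl

theorem expect_mono {p : PMF α} {F H : α → ℝ≥0∞} (h : ∀ a ∈ p.support, F a ≤ H a) :
    p.expect F ≤ p.expect H := by
  refine ENNReal.tsum_le_tsum fun a => ?_
  by_cases ha : p a = 0
  · simp [ha]
  · exact mul_le_mul_right (h a ((p.mem_support_iff a).2 ha)) _

theorem expect_add (p : PMF α) (F H : α → ℝ≥0∞) :
    p.expect (fun a => F a + H a) = p.expect F + p.expect H := by
  simp only [expect, mul_add, ENNReal.tsum_add]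

theorem expect_const_mul (p : PMF α) (c : ℝ≥0∞) (F : α → ℝ≥0∞) :
    p.expect (fun a => c * F a) = c * p.expect F := by
  simp only [expect, mul_left_comm _ c, ENNReal.tsum_mul_left]

theorem expect_const (p : PMF α) (c : ℝ≥0∞) : p.expect (fun _ => c) = c := by
  simp only [expect, ENNReal.tsum_mul_right, PMF.tsum_coe, one_mul]

theorem toOuterMeasure_eq_expect (p : PMF α) (S : Set α) :
    p.toOuterMeasure S = p.expect (S.indicator 1) := by
  rw [PMF.toOuterMeasure_apply]
  refine tsum_congr fun a => ?_
  by_cases ha : a ∈ S <;> simp [ha]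

theorem toOuterMeasure_le_one (p : PMF α) (S : Set α) :
    p.toOuterMeasure S ≤ 1 := by
  rw [toOuterMeasure_eq_expect, ← expect_const p 1]
  exact expect_mono fun a _ => Set.indicator_le_self' (fun _ _ => zero_le_one) a

/-- Chebyshev's inequality for the complementary event. -/
theorem one_le_toOuterMeasure_add (p : PMF α) (S : Set α) (X : α → ℝ) {r B : ℝ} (hr : 0 < r)
    (hS : ∀ a, a ∉ S → r ≤ X a ^ 2) (hB : p.expect (fun a => ENNReal.ofReal (X a ^ 2)) ≤
      ENNReal.ofReal B) :
    1 ≤ p.toOuterMeasure S + ENNReal.ofReal (B / r) := by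
  have h1 : p.expect (fun a => S.indicator 1 a + ENNReal.ofReal r⁻¹ * ENNReal.ofReal (X a ^ 2))
      ≤ p.toOuterMeasure S + ENNReal.ofReal (B / r) := by
    rw [expect_add, expect_const_mul, ← toOuterMeasure_eq_expect, div_eq_inv_mul,
      ENNReal.ofReal_mul (inv_pos.2 hr).le]
    gcongr
  refine le_trans ?_ h1
  rw [← expect_const p 1]
  refine expect_mono fun a _ => ?_
  by_cases ha : a ∈ S
  · simp [ha]
  · rw [Set.indicator_of_notMem ha, zero_add, ← ENNReal.ofReal_mul (inv_pos.2 hr).le,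
      ENNReal.one_le_ofReal, ← div_eq_inv_mul, one_le_div hr]
    exact hS a ha

end PMF

/-! ### In-degrees of blocks -/

namespace DirMultigraph

/-- The number of edges pointing into the `i`-th block of `m` consecutive vertices, blocks being
labelled by all natural numbers. -/
def blockIn (m : ℕ) {n : ℕ} (G : DirMultigraph (Fin n) (Fin n)) (i : ℕ) : ℕ :=
  ∑ e, if (G.tgt e : ℕ) / m = i then 1 else 0

/-- For `k ≥ 1`, the number of blocks of in-degree at least `k`. For `k = 0` it is the
(possibly fractional) number of blocks `n / m`, so that it grows by exactly `1 / m` at each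
step. -/
noncomputable def tailCount (m : ℕ) {n : ℕ} (G : DirMultigraph (Fin n) (Fin n)) : ℕ → ℝ
  | 0 => n / m
  | k + 1 => ∑ i ∈ Finset.range n, if k + 1 ≤ G.blockIn m i then 1 else 0

variable {m n : ℕ} (G : DirMultigraph (Fin n) (Fin n))

theorem blockIn_addVertex (j : Fin (n + 1)) (i : ℕ) :
    (G.addVertex j).blockIn m i = G.blockIn m i + if (j : ℕ) / m = i then 1 else 0 := by
  simp [blockIn, addVertex, Fin.sum_univ_castSucc]

theorem blockIn_eq_zero {i : ℕ} (hi : n ≤ i) : G.blockIn m i = 0 := by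
  refine Finset.sum_eq_zero fun e _ => if_neg fun h => ?_
  have := Nat.div_le_self (G.tgt e : ℕ) m
  have := (G.tgt e).isLt
  omega

/-- A block with an incoming edge is either complete or the block of the next vertex. -/
theorem blockIn_eq_zero_of_div_lt {i : ℕ} (hi : n / m < i) : G.blockIn m i = 0 := by
  refine Finset.sum_eq_zero fun e _ => if_neg fun h => ?_
  have := Nat.div_le_div_right (c := m) (G.tgt e).isLt.le
  omega

theorem tailCount_addVertex (j : Fin (n + 1)) (k : ℕ) :
    (G.addVertex j).tailCount m (k + 1) =
      G.tailCount m (k + 1) + if G.blockIn m ((j : ℕ) / m) = k then 1 else 0 := by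
  have hj : (j : ℕ) / m ∈ Finset.range (n + 1) := by
    have := Nat.div_le_self (j : ℕ) m
    have := j.isLt
    simp; omega
  have h0 : G.tailCount m (k + 1) =
      ∑ i ∈ Finset.range (n + 1), if k + 1 ≤ G.blockIn m i then (1 : ℝ) else 0 := by
    rw [Finset.sum_range_succ, G.blockIn_eq_zero le_rfl]
    simp [tailCount]
  have h1 : (if G.blockIn m ((j : ℕ) / m) = k then (1 : ℝ) else 0) =
      ∑ i ∈ Finset.range (n + 1),
        if (j : ℕ) / m = i then (if G.blockIn m i = k then 1 else 0) else 0 := by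
    rw [Finset.sum_ite_eq, if_pos hj]
  rw [h0, h1, ← Finset.sum_add_distrib, tailCount]
  refine Finset.sum_congr rfl fun i _ => ?_
  rw [blockIn_addVertex]
  split_ifs <;> first | omega | norm_num

theorem tailCount_sub_tailCount (k : ℕ) :
    G.tailCount m (k + 1) - G.tailCount m (k + 2) =
      ∑ i ∈ Finset.range n, if G.blockIn m i = k + 1 then 1 else 0 := by
  rw [tailCount, tailCount, ← Finset.sum_sub_distrib]
  refine Finset.sum_congr rfl fun i _ => ?_
  split_ifs <;> first | omega | norm_num

theorem tailCount_nonneg (k : ℕ) : 0 ≤ G.tailCount m k := by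
  cases k with
  | zero => exact div_nonneg (Nat.cast_nonneg _) (Nat.cast_nonneg _)
  | succ k => exact Finset.sum_nonneg fun i _ => by split_ifs <;> norm_num

theorem tailCount_le (hm : 1 ≤ m) (k : ℕ) : G.tailCount m k ≤ n := by
  cases k with
  | zero => exact div_le_self (Nat.cast_nonneg _) (by exact_mod_cast hm)
  | succ k =>
    calc G.tailCount m (k + 1) ≤ ∑ i ∈ Finset.range n, (1 : ℝ) :=
          Finset.sum_le_sum fun i _ => by split_ifs <;> norm_num
      _ = n := by simp

end DirMultigraph

/-! ### The probability of hitting a block of given in-degree -/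

namespace DirMultigraph

variable {m n : ℕ} (G : DirMultigraph (Fin n) (Fin n))

/-- The numerator of `attachProb`, as a real number. -/
noncomputable def weight (i : Fin (n + 1)) : ℝ :=
  Fin.lastCases (motive := fun _ => ℝ) 1 (fun s : Fin n => (G.degree s : ℝ)) i

theorem weight_nonneg (i : Fin (n + 1)) : 0 ≤ G.weight i := by
  refine Fin.lastCases ?_ (fun s => ?_) i <;> simp [weight]

theorem attachProb_eq_ofReal (i : Fin (n + 1)) :
    G.attachProb i = ENNReal.ofReal (G.weight i / (2 * n + 1)) := by
  have h : ENNReal.ofReal (2 * n + 1) = 2 * n + 1 := by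
    rw [ENNReal.ofReal_add (by positivity) zero_le_one, ENNReal.ofReal_mul zero_le_two]
    simp
  rw [ENNReal.ofReal_div_of_pos (by positivity), h]
  refine Fin.lastCases ?_ (fun s => ?_) i <;> simp [weight, attachProb]

theorem sum_weight : ∑ i, G.weight i = 2 * n + 1 := by
  have h : ∑ s, (G.degree s : ℝ) = 2 * n := by
    have := G.sum_degree
    rw [Fintype.card_fin] at this
    exact_mod_cast this
  simp [Fin.sum_univ_castSucc, weight, h]

theorem expect_attach_ofReal {F : Fin (n + 1) → ℝ} (hF : ∀ i, 0 ≤ F i) :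
    G.attach.expect (fun i => ENNReal.ofReal (F i)) =
      ENNReal.ofReal (∑ i, G.weight i / (2 * n + 1) * F i) := by
  have hw : ∀ i, 0 ≤ G.weight i / (2 * n + 1) := fun i =>
    div_nonneg (G.weight_nonneg i) (by positivity)
  rw [PMF.expect, tsum_fintype, ENNReal.ofReal_sum_of_nonneg fun i _ => mul_nonneg (hw i) (hF i)]
  refine Finset.sum_congr rfl fun i _ => ?_
  rw [ENNReal.ofReal_mul (hw i), ← attachProb_eq_ofReal]
  rfl

/-- Every vertex has out-degree one: the edge number `e` leaves the vertex number `e`. -/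
theorem src_eq_of_mem_support_prefOne {n : ℕ} {G : DirMultigraph (Fin n) (Fin n)}
    (hG : G ∈ (prefOne n).support) : G.src = id := by
  induction n with
  | zero => exact Subsingleton.elim _ _
  | succ n ih =>
    simp only [prefOne, PMF.mem_support_bind_iff, PMF.mem_support_map_iff] at hG
    obtain ⟨H, hH, i, -, rfl⟩ := hG
    funext e
    refine Fin.lastCases ?_ (fun s => ?_) e <;> simp [addVertex, ih hH]

theorem degree_eq (hG : G.src = id) (s : Fin n) : G.degree s = G.inDegree s + 1 := by
  simp [degree, outDegree, hG, Finset.filter_eq']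

theorem sum_inDegree_mul (f : Fin n → ℝ) :
    ∑ s, (G.inDegree s : ℝ) * f s = ∑ e, f (G.tgt e) := by
  simp only [inDegree, Finset.card_filter, Nat.cast_sum, Finset.sum_mul]
  rw [Finset.sum_comm]
  simp

theorem sum_tgt_block (f : ℕ → ℝ) :
    ∑ e, f ((G.tgt e : ℕ) / m) = ∑ i ∈ Finset.range n, (G.blockIn m i : ℝ) * f i := by
  simp only [blockIn, Nat.cast_sum, Finset.sum_mul]
  rw [Finset.sum_comm]
  refine Finset.sum_congr rfl fun e _ => ?_
  have : (G.tgt e : ℕ) / m < n := (Nat.div_le_self _ _).trans_lt (G.tgt e).isLt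
  simp [this]

/-- The number of vertices lying in blocks of in-degree at least `k`. -/
noncomputable def vertexTailCount (m : ℕ) {n : ℕ} (G : DirMultigraph (Fin n) (Fin n)) (k : ℕ) :
    ℝ :=
  ∑ s : Fin n, if k ≤ G.blockIn m ((s : ℕ) / m) then 1 else 0

theorem sum_fin_block (f : ℕ → ℝ) :
    ∑ s : Fin n, f ((s : ℕ) / m) = ∑ i ∈ Finset.range n,
      ((Finset.range n).filter fun s => s / m = i).card * f i := by
  rw [← Finset.sum_range fun s => f (s / m),
    ← Finset.sum_fiberwise_of_maps_to (t := Finset.range n) (g := fun s => s / m) fun s hs =>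
      Finset.mem_range.2 ((Nat.div_le_self s m).trans_lt (Finset.mem_range.1 hs))]
  refine Finset.sum_congr rfl fun i _ => ?_
  rw [Finset.sum_congr rfl fun s hs => by rw [(Finset.mem_filter.1 hs).2], Finset.sum_const,
    nsmul_eq_mul]

/-- All blocks have `m` vertices except possibly the last one, which has at most `m`. -/
theorem vertexTailCount_bounds (hm : 1 ≤ m) (k : ℕ) :
    m * G.tailCount m k - m ≤ G.vertexTailCount m k ∧
      G.vertexTailCount m k ≤ m * G.tailCount m k := by
  have hm0 : (0 : ℝ) < m := by exact_mod_cast hm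
  cases k with
  | zero =>
    have : (m : ℝ) * (n / m) = n := by field_simp
    simp [vertexTailCount, tailCount, this]
  | succ k =>
    have hcard : ∀ i : ℕ, (((Finset.range n).filter fun s => s / m = i).card : ℝ) ≤ m := by
      intro i
      have : ((Finset.range n).filter fun s => s / m = i) ⊆ Finset.Ico (i * m) (i * m + m) := by
        intro s hs
        rw [Finset.mem_filter, Nat.div_eq_iff (by omega)] at hs
        rw [Finset.mem_Ico]
        omega
      have := Finset.card_le_card this
      rw [Nat.card_Ico] at this
      exact_mod_cast this.trans (by omega)
    have hcard' : ∀ i : ℕ, i < n / m →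
        (m : ℝ) ≤ ((Finset.range n).filter fun s => s / m = i).card := by
      intro i hi
      have : Finset.Ico (i * m) (i * m + m) ⊆ ((Finset.range n).filter fun s => s / m = i) := by
        intro s hs
        have h1 : (i + 1) * m ≤ n := (Nat.le_div_iff_mul_le (by omega)).1 hi
        rw [add_mul] at h1
        rw [Finset.mem_Ico] at hs
        rw [Finset.mem_filter, Nat.div_eq_iff (by omega), Finset.mem_range]
        omega
      have := Finset.card_le_card this
      rw [Nat.card_Ico] at this
      exact_mod_cast (by omega : m ≤ i * m + m - i * m).trans this
    rw [vertexTailCount, sum_fin_block (fun i => if k + 1 ≤ G.blockIn m i then 1 else 0), tailCount,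
      Finset.mul_sum]
    constructor
    · rw [sub_le_iff_le_add]
      calc _ ≤ ∑ i ∈ Finset.range n, ((((Finset.range n).filter fun s => s / m = i).card : ℝ) *
              (if k + 1 ≤ G.blockIn m i then 1 else 0) + if i = n / m then (m : ℝ) else 0) := by
            refine Finset.sum_le_sum fun i _ => ?_
            rcases lt_trichotomy i (n / m) with h | h | h
            · rw [if_neg h.ne, add_zero]
              exact mul_le_mul_of_nonneg_right (hcard' i h) (by split_ifs <;> norm_num)
            · rw [if_pos h]
              split_ifs
              · simp
              · simp
            · rw [G.blockIn_eq_zero_of_div_lt h]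
              simp [h.ne']
        _ ≤ _ := by
            rw [Finset.sum_add_distrib]
            gcongr
            rw [Finset.sum_ite_eq']
            split_ifs <;> simp
    · exact Finset.sum_le_sum fun i _ =>
        mul_le_mul_of_nonneg_right (hcard i) (by split_ifs <;> norm_num)

/-- The total weight of the positions at which the next edge would hit a block of in-degree `k`
is, up to a bounded error, `k + m` times the number of such blocks. -/
theorem abs_sum_weight_sub_le (hm : 1 ≤ m) (hG : G.src = id) (k : ℕ) :
    |∑ j : Fin (n + 1), G.weight j * (if G.blockIn m ((j : ℕ) / m) = k then 1 else 0) -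
      (k + m) * (G.tailCount m k - G.tailCount m (k + 1))| ≤ m + 1 := by
  set f : ℕ → ℝ := fun i => if G.blockIn m i = k then 1 else 0 with hf
  have h1 : ∑ j : Fin (n + 1), G.weight j * f ((j : ℕ) / m) =
      ∑ i ∈ Finset.range n, (G.blockIn m i : ℝ) * f i + ∑ s : Fin n, f ((s : ℕ) / m)
        + f (n / m) := by
    rw [← sum_tgt_block, ← G.sum_inDegree_mul fun s => f ((s : ℕ) / m), ← Finset.sum_add_distrib,
      Fin.sum_univ_castSucc]
    simp [weight, G.degree_eq hG, add_mul]
  have h2 : ∑ i ∈ Finset.range n, (G.blockIn m i : ℝ) * f i =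
      k * (G.tailCount m k - G.tailCount m (k + 1)) := by
    rcases k with _ | k
    · simp only [hf, Nat.cast_zero, zero_mul]
      refine Finset.sum_eq_zero fun i _ => ?_
      split_ifs with h <;> simp [h]
    · rw [tailCount_sub_tailCount, Finset.mul_sum]
      refine Finset.sum_congr rfl fun i _ => ?_
      simp only [hf]
      split_ifs with h <;> simp [h]
  have h3 : ∑ s : Fin n, f ((s : ℕ) / m) = G.vertexTailCount m k - G.vertexTailCount m (k + 1) := by
    rw [vertexTailCount, vertexTailCount, ← Finset.sum_sub_distrib]
    refine Finset.sum_congr rfl fun s _ => ?_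
    simp only [hf]
    split_ifs <;> first | omega | norm_num
  have h4 : 0 ≤ f (n / m) ∧ f (n / m) ≤ 1 := by
    simp only [hf]
    split_ifs <;> norm_num
  have h5 := G.vertexTailCount_bounds hm k
  have h6 := G.vertexTailCount_bounds hm (k + 1)
  rw [h1, h2, h3, abs_le]
  constructor <;> linarith [h4.1, h4.2, h5.1, h5.2, h6.1, h6.2]

end DirMultigraph

/-! ### The second moment of the deviation from the limit profile -/

/-- The limit of `tailCount m G k / n`, a telescoped form of the limiting degree distribution. -/
noncomputable def tailLimit (m k : ℕ) : ℝ :=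
  (m + 1) / ((k + m) * (k + m + 1))

theorem tailLimit_nonneg (m k : ℕ) : 0 ≤ tailLimit m k := by
  unfold tailLimit
  positivity

theorem tailLimit_le_one {m : ℕ} (hm : 1 ≤ m) (k : ℕ) : tailLimit m k ≤ 1 := by
  have hm0 : (1 : ℝ) ≤ m := by exact_mod_cast hm
  have hk0 : (0 : ℝ) ≤ k := k.cast_nonneg
  unfold tailLimit
  rw [div_le_one (by positivity)]
  nlinarith

/-- The stationarity equation of the mean-field recursion. -/
theorem tailLimit_succ {m : ℕ} (hm : 1 ≤ m) (k : ℕ) :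
    (k + m) * (tailLimit m k - tailLimit m (k + 1)) = 2 * tailLimit m (k + 1) := by
  have hm0 : (0 : ℝ) < m := by exact_mod_cast hm
  unfold tailLimit
  push_cast
  field_simp
  ring

namespace DirMultigraph

/-- The deviation of `tailCount` from its deterministic approximation. The factor `(2 n + 1) / 2`
in place of `n` makes this approximation an exact solution of the mean-field recursion. -/
noncomputable def tailDev (m : ℕ) {n : ℕ} (G : DirMultigraph (Fin n) (Fin n)) (k : ℕ) : ℝ :=
  G.tailCount m k - tailLimit m k * ((2 * n + 1) / 2)

variable {m n : ℕ} (G : DirMultigraph (Fin n) (Fin n))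

theorem abs_tailDev_le (hm : 1 ≤ m) (k : ℕ) : |G.tailDev m k| ≤ (2 * n + 1) / 2 := by
  have h1 := G.tailCount_nonneg (m := m) k
  have h2 := G.tailCount_le hm k
  have h3 := tailLimit_nonneg m k
  have h4 := tailLimit_le_one hm k
  have h5 : (0 : ℝ) ≤ (2 * n + 1) / 2 := by positivity
  have h6 := mul_nonneg h3 h5
  have h7 := mul_le_mul_of_nonneg_right h4 h5
  rw [tailDev, abs_le]
  constructor <;> linarith

theorem sq_tailDev_zero_le (hm : 1 ≤ m) : G.tailDev m 0 ^ 2 ≤ 1 := by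
  have hm0 : (1 : ℝ) ≤ m := by exact_mod_cast hm
  have : G.tailDev m 0 = -(1 / (2 * m)) := by
    simp only [tailDev, tailCount, tailLimit]
    push_cast
    field_simp
    ring
  rw [this, neg_sq, sq_le_one_iff₀ (by positivity), div_le_one (by positivity)]
  linarith

/-- One step of the process, in mean square. The deviation at `k + 1` is replaced by a convex
combination of the deviations at `k + 1` and `k`, up to a noise of bounded variance and a drift of
size `O(1 / n)`, whose product with the deviation is bounded. -/
theorem expect_sq_tailDev_addVertex_le (hm : 1 ≤ m) (hG : G.src = id) (k : ℕ) :
    G.attach.expect (fun j => ENNReal.ofReal ((G.addVertex j).tailDev m (k + 1) ^ 2)) ≤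
      ENNReal.ofReal ((1 - (k + m) / (2 * n + 1)) * G.tailDev m (k + 1) ^ 2 +
        (k + m) / (2 * n + 1) * G.tailDev m k ^ 2 + (m + 3)) := by
  rw [G.expect_attach_ofReal fun j => sq_nonneg _]
  refine ENNReal.ofReal_le_ofReal ?_
  have hn : (0 : ℝ) < 2 * n + 1 := by positivity
  set J : Fin (n + 1) → ℝ := fun j => if G.blockIn m ((j : ℕ) / m) = k then 1 else 0 with hJ
  set τ := tailLimit m (k + 1) with hτ
  set Y := G.tailDev m (k + 1) with hY
  set Z := G.tailDev m k with hZ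
  set S := ∑ j, G.weight j * J j with hS
  have hstep : ∀ j, (G.addVertex j).tailDev m (k + 1) = Y - τ + J j := by
    intro j
    simp only [hY, tailDev, tailCount_addVertex, hJ, hτ]
    push_cast
    ring
  have hJ2 : ∀ j, J j ^ 2 = J j := by
    intro j
    simp only [hJ]
    split_ifs <;> norm_num
  have hsum : ∑ j, G.weight j / (2 * n + 1) * (G.addVertex j).tailDev m (k + 1) ^ 2 =
      (Y - τ) ^ 2 + S / (2 * n + 1) * (2 * (Y - τ) + 1) := by
    have h1 : ∀ j, G.weight j / (2 * n + 1) * (G.addVertex j).tailDev m (k + 1) ^ 2 =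
        G.weight j * ((Y - τ) ^ 2 / (2 * n + 1)) +
          G.weight j * J j * ((2 * (Y - τ) + 1) / (2 * n + 1)) := by
      intro j
      rw [hstep, add_sq, hJ2]
      ring
    rw [Finset.sum_congr rfl fun j _ => h1 j, Finset.sum_add_distrib, ← Finset.sum_mul,
      ← Finset.sum_mul, sum_weight, ← hS]
    field_simp
  have hS0 : 0 ≤ S := Finset.sum_nonneg fun j _ => mul_nonneg (G.weight_nonneg j) <| by
    simp only [hJ]
    split_ifs <;> norm_num
  have hS1 : S ≤ 2 * n + 1 := by
    rw [← G.sum_weight]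
    refine Finset.sum_le_sum fun j _ => mul_le_of_le_one_right (G.weight_nonneg j) ?_
    simp only [hJ]
    split_ifs <;> norm_num
  have hρ := G.abs_sum_weight_sub_le hm hG k
  rw [← hS] at hρ
  -- the hitting probability in terms of the deviations
  have hdiff : (k + m) * (G.tailCount m k - G.tailCount m (k + 1)) =
      (k + m) * (Z - Y) + (2 * n + 1) * τ := by
    have := tailLimit_succ hm k
    simp only [hZ, hY, tailDev]
    linear_combination (2 * (n : ℝ) + 1) / 2 * this
  rw [hdiff] at hρ
  set R := S - ((k + m) * (Z - Y) + (2 * n + 1) * τ) with hR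
  have hYR : 2 * Y * R / (2 * n + 1) ≤ m + 1 := by
    rw [div_le_iff₀ hn]
    calc 2 * Y * R ≤ 2 * (|Y| * |R|) := by
          rw [← abs_mul]
          linarith [le_abs_self (Y * R)]
      _ ≤ 2 * ((2 * n + 1) / 2 * (m + 1)) := by
          have := G.abs_tailDev_le hm (k + 1)
          gcongr
      _ = _ := by ring
  have hτ0 : 0 ≤ τ := tailLimit_nonneg m (k + 1)
  have hτ1 : τ ≤ 1 := tailLimit_le_one hm (k + 1)
  have hh0 : 0 ≤ S / (2 * n + 1) := div_nonneg hS0 hn.le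
  have hh1 : S / (2 * n + 1) ≤ 1 := (div_le_one hn).2 hS1
  have hq : 0 ≤ (k + m) / (2 * (n : ℝ) + 1) * (Z - Y) ^ 2 := by positivity
  have hSexp : S / (2 * n + 1) = (k + m) / (2 * n + 1) * (Z - Y) + τ + R / (2 * n + 1) := by
    rw [hR]
    field_simp
    ring
  rw [hsum]
  have key : (Y - τ) ^ 2 + S / (2 * n + 1) * (2 * (Y - τ) + 1) =
      Y ^ 2 - 2 * Y * τ + 2 * Y * (S / (2 * n + 1)) +
        (τ ^ 2 - 2 * (S / (2 * n + 1)) * τ + S / (2 * n + 1)) := by ring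
  have hnoise : τ ^ 2 - 2 * (S / (2 * n + 1)) * τ + S / (2 * n + 1) ≤ 2 := by
    nlinarith [mul_nonneg hh0 hτ0]
  -- `2 * Y * (Z - Y) = Z ^ 2 - Y ^ 2 - (Z - Y) ^ 2`: the convexity of the square, with its defect
  have hmain : Y ^ 2 - 2 * Y * τ + 2 * Y * (S / (2 * n + 1)) =
      (1 - (k + m) / (2 * n + 1)) * Y ^ 2 + (k + m) / (2 * n + 1) * Z ^ 2
        - (k + m) / (2 * n + 1) * (Z - Y) ^ 2 + 2 * Y * R / (2 * n + 1) := by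
    rw [hSexp]
    ring
  rw [key, hmain]
  linarith

end DirMultigraph

open DirMultigraph

/-- The second moment of the deviation grows at most linearly. The term `(k + m) ^ 2` covers the
first steps, where the convex combination of the recursion has a negative coefficient. -/
theorem expect_sq_tailDev_le {m : ℕ} (hm : 1 ≤ m) (n k : ℕ) :
    (prefOne n).expect (fun G => ENNReal.ofReal (G.tailDev m k ^ 2)) ≤
      ENNReal.ofReal ((m + 3) * n + (k + m) ^ 2) := by
  have hm0 : (1 : ℝ) ≤ m := by exact_mod_cast hm
  have hconst : ∀ n k : ℕ, (∀ G : DirMultigraph (Fin n) (Fin n), G.tailDev m k ^ 2 ≤ (k + m) ^ 2) →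
      (prefOne n).expect (fun G => ENNReal.ofReal (G.tailDev m k ^ 2)) ≤
        ENNReal.ofReal ((m + 3) * n + (k + m) ^ 2) := by
    intro n k h
    rw [← PMF.expect_const (prefOne n) (ENNReal.ofReal ((m + 3) * n + (k + m) ^ 2))]
    refine PMF.expect_mono fun G _ => ENNReal.ofReal_le_ofReal ((h G).trans ?_)
    have : (0 : ℝ) ≤ (m + 3) * n := by positivity
    linarith
  have hsmall : ∀ n k : ℕ, (2 * (n : ℝ) + 1) / 2 ≤ k + m →
      (prefOne n).expect (fun G => ENNReal.ofReal (G.tailDev m k ^ 2)) ≤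
        ENNReal.ofReal ((m + 3) * n + (k + m) ^ 2) := by
    intro n k h
    refine hconst n k fun G => ?_
    rw [← sq_abs (G.tailDev m k)]
    have := (G.abs_tailDev_le hm k).trans h
    gcongr
  induction n generalizing k with
  | zero =>
    refine hsmall 0 k ?_
    have hk0 : (0 : ℝ) ≤ k := k.cast_nonneg
    norm_num
    linarith
  | succ n ih =>
    cases k with
    | zero =>
      refine hconst _ _ fun G => (G.sq_tailDev_zero_le hm).trans ?_
      push_cast
      nlinarith
    | succ k =>
      rcases lt_or_ge (2 * (n : ℝ) + 1) (k + m) with hlt | hge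
      · refine hsmall _ _ ?_
        push_cast
        linarith
      have hn : (0 : ℝ) < 2 * n + 1 := by positivity
      set q : ℝ := (k + m) / (2 * n + 1) with hq
      have hq0 : 0 ≤ q := by positivity
      have hq1 : 0 ≤ 1 - q := sub_nonneg.2 ((div_le_one hn).2 hge)
      rw [prefOne, PMF.expect_bind]
      calc _ ≤ (prefOne n).expect fun G => ENNReal.ofReal (1 - q) *
              ENNReal.ofReal (G.tailDev m (k + 1) ^ 2) + ENNReal.ofReal q *
                ENNReal.ofReal (G.tailDev m k ^ 2) + ENNReal.ofReal (m + 3) := by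
            refine PMF.expect_mono fun G hG => ?_
            rw [PMF.expect_map]
            refine (G.expect_sq_tailDev_addVertex_le hm
              (src_eq_of_mem_support_prefOne hG) k).trans_eq ?_
            rw [ENNReal.ofReal_add (by positivity) (by positivity),
              ENNReal.ofReal_add (by positivity) (by positivity), ENNReal.ofReal_mul hq1,
              ENNReal.ofReal_mul hq0]
        _ = ENNReal.ofReal (1 - q) *
              (prefOne n).expect (fun G => ENNReal.ofReal (G.tailDev m (k + 1) ^ 2)) +
            ENNReal.ofReal q * (prefOne n).expect (fun G => ENNReal.ofReal (G.tailDev m k ^ 2)) +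
            ENNReal.ofReal (m + 3) := by
            rw [PMF.expect_add, PMF.expect_add, PMF.expect_const_mul, PMF.expect_const_mul,
              PMF.expect_const]
        _ ≤ ENNReal.ofReal (1 - q) * ENNReal.ofReal ((m + 3) * n + ((k + 1 : ℕ) + m) ^ 2) +
            ENNReal.ofReal q * ENNReal.ofReal ((m + 3) * n + (k + m) ^ 2) +
            ENNReal.ofReal (m + 3) := by
            gcongr
            · exact ih (k + 1)
            · exact ih k
        _ = ENNReal.ofReal ((1 - q) * ((m + 3) * n + ((k + 1 : ℕ) + m) ^ 2) +
            q * ((m + 3) * n + (k + m) ^ 2) + (m + 3)) := by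
            rw [← ENNReal.ofReal_mul hq1, ← ENNReal.ofReal_mul hq0,
              ← ENNReal.ofReal_add (by positivity) (by positivity),
              ← ENNReal.ofReal_add (by positivity) (by positivity)]
        _ ≤ _ := by
            refine ENNReal.ofReal_le_ofReal ?_
            push_cast
            have hk : 0 ≤ q * (2 * (k + m) + 1) := by positivity
            nlinarith

/-! ### The degree distribution of the graph with identified vertices -/

/-- The limiting proportion of vertices of in-degree `d`. -/
noncomputable def degreeLimit (m d : ℕ) : ℝ :=
  2 * m * (m + 1) / ((d + m) * (d + m + 1) * (d + m + 2))

theorem degreeLimit_eq {m : ℕ} (hm : 1 ≤ m) (d : ℕ) :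
    degreeLimit m d = m * (tailLimit m d - tailLimit m (d + 1)) := by
  have hm0 : (0 : ℝ) < m := by exact_mod_cast hm
  unfold degreeLimit tailLimit
  push_cast
  field_simp
  ring

theorem le_degreeLimit {m d : ℕ} (hd : 1 ≤ d) :
    2 * m * (m + 1) / (m + 3 : ℝ) ^ 3 / d ^ 3 ≤ degreeLimit m d := by
  have hd0 : (1 : ℝ) ≤ d := by exact_mod_cast hd
  have hm0 : (0 : ℝ) ≤ m := m.cast_nonneg
  rw [degreeLimit, div_div]
  have h : (d : ℝ) + m + 2 ≤ (m + 3) * d := by nlinarith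
  refine div_le_div_of_nonneg_left (by positivity) (by positivity) ?_
  calc ((d : ℝ) + m) * (d + m + 1) * (d + m + 2)
      ≤ (d + m + 2) * (d + m + 2) * (d + m + 2) := by
        have h1 : (d : ℝ) + m ≤ d + m + 2 := by linarith
        have h2 : (d : ℝ) + m + 1 ≤ d + m + 2 := by linarith
        exact mul_le_mul_of_nonneg_right (mul_le_mul h1 h2 (by positivity) (by positivity))
          (by positivity)
    _ ≤ ((m + 3) * d) * ((m + 3) * d) * ((m + 3) * d) := by gcongr
    _ = _ := by ring

theorem degreeLimit_le {m d : ℕ} (hd : 1 ≤ d) :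
    degreeLimit m d ≤ 2 * m * (m + 1) / d ^ 3 := by
  have hd0 : (1 : ℝ) ≤ d := by exact_mod_cast hd
  have hm0 : (0 : ℝ) ≤ m := m.cast_nonneg
  rw [degreeLimit]
  refine div_le_div_of_nonneg_left (by positivity) (by positivity) ?_
  calc (d : ℝ) ^ 3 = d * d * d := by ring
    _ ≤ _ := by gcongr <;> linarith

namespace DirMultigraph

variable {m n : ℕ}

theorem inDegree_mapVertices_divNat (G : DirMultigraph (Fin (n * m)) (Fin (n * m))) (v : Fin n) :
    (G.mapVertices Fin.divNat).inDegree v = G.blockIn m v := by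
  rw [inDegree, blockIn, Finset.card_filter]
  exact Finset.sum_congr rfl fun e _ => by simp only [mapVertices, Fin.ext_iff, Fin.coe_divNat]

theorem numInDegree_mapVertices_divNat (hm : 1 ≤ m)
    (G : DirMultigraph (Fin (n * m)) (Fin (n * m))) {d : ℕ} (hd : 1 ≤ d) :
    ((G.mapVertices Fin.divNat).numInDegree d : ℝ) =
      G.tailCount m d - G.tailCount m (d + 1) := by
  obtain ⟨k, rfl⟩ := Nat.exists_eq_add_of_le' hd
  rw [tailCount_sub_tailCount, numInDegree, Finset.card_filter, Nat.cast_sum]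
  simp only [inDegree_mapVertices_divNat]
  rw [← Finset.sum_range fun i => ((if G.blockIn m i = k + 1 then 1 else 0 : ℕ) : ℝ)]
  have hsub : Finset.range n ⊆ Finset.range (n * m) :=
    Finset.range_subset_range.2 (Nat.le_mul_of_pos_right n hm)
  rw [← Finset.sum_subset hsub]
  · simp
  · intro i _ hi
    have : G.blockIn m i = 0 := by
      refine Finset.sum_eq_zero fun e _ => if_neg fun h => hi ?_
      rw [← h, Finset.mem_range]
      exact Nat.div_lt_of_lt_mul ((G.tgt e).isLt.trans_eq (mul_comm n m))
    simp [this]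

end DirMultigraph

open DirMultigraph

/-- Bias and variance together: the deviations at `d` and `d + 1`, plus a bias of at most `1 / 2`
coming from the factor `(2 n + 1) / 2` in the mean-field solution. -/
theorem expect_sq_numInDegree_sub_le {m : ℕ} (hm : 1 ≤ m) {n d : ℕ} (hd : 1 ≤ d)
    (hdn : d ^ 2 ≤ n) :
    (prefGraph m n).expect
        (fun G => ENNReal.ofReal (((G.numInDegree d : ℝ) - degreeLimit m d * n) ^ 2)) ≤
      ENNReal.ofReal (3 * (2 * m * (m + 3) + 2 * (m + 2) ^ 2 + 1) * n) := by
  have hm0 : (1 : ℝ) ≤ m := by exact_mod_cast hm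
  have hd0 : (1 : ℝ) ≤ d := by exact_mod_cast hd
  have hdn' : (d : ℝ) ^ 2 ≤ n := by exact_mod_cast hdn
  rw [prefGraph, PMF.expect_map]
  calc _ ≤ (prefOne (n * m)).expect fun G => 3 * (ENNReal.ofReal (G.tailDev m d ^ 2) +
          ENNReal.ofReal (G.tailDev m (d + 1) ^ 2) + ENNReal.ofReal 1) := by
        refine PMF.expect_mono fun G _ => ?_
        rw [Function.comp_apply, numInDegree_mapVertices_divNat hm G hd,
          ← ENNReal.ofReal_add (by positivity) (by positivity),
          ← ENNReal.ofReal_add (by positivity) (by positivity),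
          ← ENNReal.ofReal_ofNat 3, ← ENNReal.ofReal_mul (by positivity)]
        refine ENNReal.ofReal_le_ofReal ?_
        set a := tailLimit m d - tailLimit m (d + 1) with ha
        have ha1 : a ^ 2 ≤ 1 := by
          rw [sq_le_one_iff_abs_le_one, abs_le]
          constructor <;> linarith [tailLimit_nonneg m d, tailLimit_nonneg m (d + 1),
            tailLimit_le_one hm d, tailLimit_le_one hm (d + 1)]
        have : G.tailCount m d - G.tailCount m (d + 1) - degreeLimit m d * n =
            G.tailDev m d - G.tailDev m (d + 1) + a / 2 := by
          rw [degreeLimit_eq hm]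
          simp only [tailDev, ha]
          push_cast
          ring
        rw [this]
        nlinarith [sq_nonneg (G.tailDev m d + G.tailDev m (d + 1)),
          sq_nonneg (G.tailDev m d - a / 2), sq_nonneg (G.tailDev m (d + 1) + a / 2)]
    _ = 3 * ((prefOne (n * m)).expect (fun G => ENNReal.ofReal (G.tailDev m d ^ 2)) +
          (prefOne (n * m)).expect (fun G => ENNReal.ofReal (G.tailDev m (d + 1) ^ 2)) +
          ENNReal.ofReal 1) := by
        rw [PMF.expect_const_mul, PMF.expect_add, PMF.expect_add, PMF.expect_const]
    _ ≤ 3 * (ENNReal.ofReal ((m + 3) * (n * m : ℕ) + (d + m) ^ 2) +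
          ENNReal.ofReal ((m + 3) * (n * m : ℕ) + ((d + 1 : ℕ) + m) ^ 2) + ENNReal.ofReal 1) := by
        gcongr
        · exact expect_sq_tailDev_le hm _ _
        · exact expect_sq_tailDev_le hm _ _
    _ ≤ _ := by
        rw [← ENNReal.ofReal_add (by positivity) (by positivity),
          ← ENNReal.ofReal_add (by positivity) (by positivity),
          ← ENNReal.ofReal_ofNat 3, ← ENNReal.ofReal_mul (by positivity)]
        refine ENNReal.ofReal_le_ofReal ?_
        push_cast
        have h1 : ((d : ℝ) + 1 + m) ^ 2 ≤ (m + 2) ^ 2 * n := by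
          calc ((d : ℝ) + 1 + m) ^ 2 ≤ (((m : ℝ) + 2) * d) ^ 2 := by
                gcongr
                nlinarith
            _ = ((m : ℝ) + 2) ^ 2 * (d : ℝ) ^ 2 := by ring
            _ ≤ _ := by gcongr
        have h2 : ((d : ℝ) + m) ^ 2 ≤ (d + 1 + m) ^ 2 := by
          gcongr
          linarith
        have h3 : (1 : ℝ) ≤ n := by nlinarith
        linarith

theorem one_le_probProportion_add {m : ℕ} (hm : 1 ≤ m) {n d : ℕ} (hd : 1 ≤ d)
    (hdn : d ^ 2 ≤ n) {η : ℝ} (hη : 0 < η) :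
    1 ≤ probProportion m n d {x : ℝ | |x / degreeLimit m d - 1| ≤ η} +
      ENNReal.ofReal (3 * (2 * m * (m + 3) + 2 * (m + 2) ^ 2 + 1) * n /
        (η * (degreeLimit m d * n)) ^ 2) := by
  have hm0 : (0 : ℝ) < m := by exact_mod_cast hm
  have hn : (0 : ℝ) < n := by
    have : 0 < n := lt_of_lt_of_le (by positivity) hdn
    exact_mod_cast this
  have hα : 0 < degreeLimit m d := by
    unfold degreeLimit
    positivity
  refine PMF.one_le_toOuterMeasure_add _ _
    (fun G : DirMultigraph (Fin n) (Fin (n * m)) => (G.numInDegree d : ℝ) - degreeLimit m d * n)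
    (by positivity) ?_ (expect_sq_numInDegree_sub_le hm hd hdn)
  intro G hG
  simp only [Set.mem_ofPred_eq, not_le] at hG
  rw [← sq_abs (_ - _)]
  have : (G.numInDegree d : ℝ) - degreeLimit m d * n =
      (G.numInDegree d / n / degreeLimit m d - 1) * (degreeLimit m d * n) := by
    field_simp
  rw [this, abs_mul, abs_of_pos (mul_pos hα hn)]
  gcongr

/-- The relative concentration of the proportion of vertices of in-degree `d`. The exponent `1 / 6`
is where the square `n ^ 2 / d ^ 6` of the expected number of such vertices exceeds the variance
bound of order `n`. -/
theorem tendsto_probProportion_degreeLimit {m : ℕ} (hm : 1 ≤ m) {ε : ℝ} (hε : 0 < ε) {d : ℕ → ℕ}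
    (hd : ∀ᶠ n : ℕ in atTop, 1 ≤ d n ∧ (d n : ℝ) ≤ (n : ℝ) ^ ((1 : ℝ) / 6 - ε))
    {η : ℝ} (hη : 0 < η) :
    Tendsto (fun n : ℕ => probProportion m n (d n) {x : ℝ | |x / degreeLimit m (d n) - 1| ≤ η})
      atTop (𝓝 1) := by
  have hm0 : (0 : ℝ) < m := by exact_mod_cast hm
  set K : ℝ := 3 * (2 * m * (m + 3) + 2 * (m + 2) ^ 2 + 1) with hK
  set c : ℝ := 2 * m * (m + 1) / (m + 3) ^ 3 with hc
  have hK0 : 0 < K := by positivity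
  have hc0 : 0 < c := by positivity
  have hlim : Tendsto (fun n : ℕ => 1 - ENNReal.ofReal (K / (η * c) ^ 2 * (n : ℝ) ^ (-(6 * ε))))
      atTop (𝓝 1) := by
    have h1 : Tendsto (fun n : ℕ => K / (η * c) ^ 2 * (n : ℝ) ^ (-(6 * ε))) atTop (𝓝 0) := by
      simpa using ((tendsto_rpow_neg_atTop (by positivity : 0 < 6 * ε)).comp
        tendsto_natCast_atTop_atTop).const_mul (K / (η * c) ^ 2)
    have h2 := ENNReal.tendsto_ofReal h1
    rw [ENNReal.ofReal_zero] at h2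
    simpa using ENNReal.Tendsto.sub tendsto_const_nhds h2 (Or.inl ENNReal.one_ne_top)
  refine tendsto_of_tendsto_of_tendsto_of_le_of_le' hlim tendsto_const_nhds ?_
    (Eventually.of_forall fun n => PMF.toOuterMeasure_le_one _ _)
  filter_upwards [hd, eventually_ge_atTop 1] with n hdn hn
  obtain ⟨hd1, hd2⟩ := hdn
  have hn1 : (1 : ℝ) ≤ n := by exact_mod_cast hn
  have hd0 : (1 : ℝ) ≤ d n := by exact_mod_cast hd1
  have hd6 : (d n : ℝ) ^ 6 ≤ n * (n : ℝ) ^ (-(6 * ε)) := by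
    calc (d n : ℝ) ^ 6 ≤ ((n : ℝ) ^ ((1 : ℝ) / 6 - ε)) ^ 6 := by gcongr
      _ = n * (n : ℝ) ^ (-(6 * ε)) := by
        rw [← Real.rpow_natCast, ← Real.rpow_mul (by positivity)]
        nth_rewrite 2 [← Real.rpow_one (n : ℝ)]
        rw [← Real.rpow_add (by positivity)]
        congr 1
        push_cast
        ring
  have hdsq : d n ^ 2 ≤ n := by
    have h1 : (d n : ℝ) ^ 2 ≤ d n ^ 6 := pow_le_pow_right₀ hd0 (by norm_num)
    have h2 : (n : ℝ) ^ (-(6 * ε)) ≤ 1 := Real.rpow_le_one_of_one_le_of_nonpos hn1 (by linarith)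
    have h3 : (d n : ℝ) ^ 2 ≤ n := h1.trans (hd6.trans (mul_le_of_le_one_right (by positivity) h2))
    exact_mod_cast h3
  rw [tsub_le_iff_right]
  refine (one_le_probProportion_add hm hd1 hdsq hη).trans ?_
  gcongr
  calc K * n / (η * (degreeLimit m (d n) * n)) ^ 2
      ≤ K * n / (η * (c / d n ^ 3 * n)) ^ 2 := by
        gcongr
        exact le_degreeLimit hd1
    _ = K / (η * c) ^ 2 * (d n ^ 6 / n) := by field_simp
    _ ≤ K / (η * c) ^ 2 * (n : ℝ) ^ (-(6 * ε)) := by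
        gcongr
        rw [div_le_iff₀ (by positivity), mul_comm]
        exact hd6

theorem theorem2 (m : ℕ) (hm : 1 ≤ m) :
    ∃ c C : ℝ, 0 < c ∧ 0 < C ∧
      ∀ ε : ℝ, 0 < ε → ∀ d : ℕ → ℕ,
        (∀ᶠ n : ℕ in atTop, 1 ≤ d n ∧ (d n : ℝ) ≤ (n : ℝ) ^ ((1 : ℝ) / 6 - ε)) →
        Tendsto (fun n : ℕ =>
            probProportion m n (d n) (Set.Icc (c / (d n : ℝ) ^ 3) (C / (d n : ℝ) ^ 3)))
          atTop (𝓝 1) ∧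
        ∀ η : ℝ, 0 < η →
          Tendsto (fun n : ℕ =>
              probProportion m n (d n)
                {x : ℝ | |x / (2 * m * (m + 1) / ((d n + m) * (d n + m + 1) * (d n + m + 2))) - 1|
                  ≤ η})
            atTop (𝓝 1) := by
  have hm0 : (0 : ℝ) < m := by exact_mod_cast hm
  refine ⟨1 / 2 * (2 * m * (m + 1) / (m + 3) ^ 3), 3 / 2 * (2 * m * (m + 1)), by positivity,
    by positivity, fun ε hε d hd => ⟨?_, fun η hη =>
      tendsto_probProportion_degreeLimit hm hε hd hη⟩⟩
  refine tendsto_of_tendsto_of_tendsto_of_le_of_le'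
    (tendsto_probProportion_degreeLimit hm hε hd (η := 1 / 2) (by norm_num)) tendsto_const_nhds ?_
    (Eventually.of_forall fun n => PMF.toOuterMeasure_le_one _ _)
  filter_upwards [hd] with n hdn
  refine MeasureTheory.OuterMeasure.mono _ fun G hG => ?_
  have h1 := le_degreeLimit (m := m) hdn.1
  have h2 := degreeLimit_le (m := m) hdn.1
  have hα : 0 < degreeLimit m (d n) := by
    unfold degreeLimit
    positivity
  simp only [Set.mem_ofPred_eq, abs_le] at hG
  obtain ⟨h3, h4⟩ := hG
  rw [neg_le_sub_iff_le_add, ← sub_le_iff_le_add, le_div_iff₀ hα] at h3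
  rw [sub_le_iff_le_add, div_le_iff₀ hα] at h4
  rw [Set.mem_ofPred_eq, Set.mem_Icc, mul_div_assoc (1 / 2 : ℝ), mul_div_assoc (3 / 2 : ℝ)]
  constructor <;> linarith
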